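/- **Setting.** A matched study consists of $I$ matched sets; set $i$ has $n_i\ge 1$ subjects, $N=\sum_{i=1}^I n_i$. Set $i$ has $n_i$ observed real doses with order statistics $z_{i(1)}\le\dots\le z_{i(n_i)}$. Subject $j$ of set $i$ has fixed real potential outcomes $r_{ij}(z)$, and $r_{ij}^{(k)}=r_{ij}(z_{i(k)})$. Given arbitrary prespecified functions $f_i^{(k)}$ of a dose and an outcome, the estimand is $$\theta=\sum_{i=1}^I\frac{n_i}{N}\theta_i,\qquad \theta_i=\frac1{n_i}\sum_{j=1}^{n_i}\sum_{k=1}^{n_i} f_i^{(k)}(z_{i(k)},r_{ij}^{(k)}).$$ The only randomness is the dose assignment: in set $i$ a random permutation $\pi_i$ of $\{1,\dots,n_i\}$ gives subject $j$ the dose $Z_{ij}=z_{i(\pi_i(j))}$, with observed outcome $R_{ij}=r_{ij}(Z_{ij})$. The $n_i!$ permutations are treated as distinct even if doses are tied; accordingly the event $Z_{ij}=z_{i(k)}$ below means $\pi_i(j)=k$ (which is the literal equality when the doses of set $i$ are distinct). Let $$V_N=\sum_{i=1}^I\frac{n_i}{N}V_{N,i},\qquad V_{N,i}=\sum_{j=1}^{n_i}\sum_{k=1}^{n_i}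 f_i^{(k)}(Z_{ij},R_{ij})\,\mathbf 1\{Z_{ij}=z_{i(k)}\}.$$ For a real $I\times L$ matrix $Q$ with $L<I$ and $Q^TQ$ invertible, let $H_Q=Q(Q^TQ)^{-1}Q^T$ with diagonal entries $h_{ii}$, assume $h_{ii}<1$ for all $i$, let $y_i=V_{N,i}/\sqrt{1-h_{ii}}$, let $W$ be the diagonal matrix with entries $In_i/N$, and let $S_N(Q)\ge 0$ be the square root of $$S_N^2(Q)=I^{-2}\,\mathbf y\,W(\mathcal I-H_Q)W\,\mathbf y^T ,$$ where $\mathcal I$ is the identity matrix. $\Phi$ is the standard normal distribution function. **Theorem.** Consider a sequence of matched studies with $I\to\infty$, in which the sizes $n_i$, doses, potential outcomes, functions $f_i^{(k)}$, the number $L$ and the matrix $Q$ may all vary along the sequence. Assume that in each study the permutations $\pi_1,\dots,\pi_I$ are independent across matched sets and each $\pi_i$ is uniform on the $n_i!$ permutations (no unmeasured confounding). Assume the following regularity conditions. 1. (Lindeberg) Let $D_i=n_i(V_{N,i}-\theta_i)$ and $B^2=\sum_{i=1}^I E[D_i^2]$, expectations being averages over the $n_i!$ equally likely permutations. For all $\varepsilon>0$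 and $\delta>0$, one has $\sum_{i=1}^I E[D_i^2\mathbf 1\{|D_i|>\varepsilon B\}]\le\delta B^2$ in all studies sufficiently far along the sequence. 2. (Leverage) There are $\eta<1$ and $K\in\mathbb N$ such that in every study at most $K$ matched sets have $h_{ii}>\eta$. (This holds automatically if $L$ is bounded, because $\sum_i h_{ii}=L$.) Then for every $\alpha\in(0,1)$, $$\liminf_{I\to\infty} P\Big(\theta\in\big[V_N-\Phi^{-1}(1-\alpha/2)S_N(Q),\;V_N+\Phi^{-1}(1-\alpha/2)S_N(Q)\big]\Big)\ge 1-\alpha .$$ -/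

import Mathlib

open scoped Nat
open MeasureTheory ProbabilityTheory Filter

noncomputable section

/-- The fixed (non-random) data of a matched study with treatment doses:
`numSets` matched sets, set `i` having `size i ≥ 1` subjects and the observed doses `dose i`;
`outcome i j z` is the potential outcome `r_{ij}(z)` of subject `j` of set `i` under dose `z`, and
`contrast i k` is the prespecified function `f_i^{(k)}` of a dose and an outcome. -/
structure DoseStudy where
  numSets : ℕ
  size : Fin numSets → ℕ
  size_pos : ∀ i, 0 < size i
  dose : (i : Fin numSets) → Fin (size i) → ℝ
  outcome : (i : Fin numSets) → Fin (size i) → ℝ → ℝ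
  contrast : (i : Fin numSets) → Fin (size i) → ℝ → ℝ → ℝ

namespace DoseStudy

variable (S : DoseStudy)

/-- The total number `N = ∑ᵢ nᵢ` of subjects. -/
def total : ℕ := ∑ i, S.size i

/-- The `k`-th order statistic `z_{i(k)}` of the doses in set `i`. -/
def orderedDose (i : Fin S.numSets) (k : Fin (S.size i)) : ℝ :=
  S.dose i (Tuple.sort (S.dose i) k)

/-- `θ_i = n_i⁻¹ ∑_j ∑_k f_i^{(k)}(z_{i(k)}, r_{ij}(z_{i(k)}))`. -/
def setEstimand (i : Fin S.numSets) : ℝ :=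
  (S.size i : ℝ)⁻¹ * ∑ j, ∑ k,
    S.contrast i k (S.orderedDose i k) (S.outcome i j (S.orderedDose i k))

/-- `θ = ∑_i (n_i / N) θ_i`. -/
def estimand : ℝ := ∑ i, (S.size i : ℝ) / (S.total : ℝ) * S.setEstimand i

/-- The possible dose assignments within set `i`: all `n_i!` permutations, kept distinct even when
doses are tied. Under `π`, subject `j` receives the `π j`-th smallest dose of the set. -/
abbrev SetAssignment (i : Fin S.numSets) : Type := Equiv.Perm (Fin (S.size i))

/-- A dose assignment for the whole study. -/
abbrev Assignment : Type := (i : Fin S.numSets) → S.SetAssignment i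

/-- The dose `Z_{ij}` received by subject `j` of set `i`. -/
def assignedDose (i : Fin S.numSets) (π : S.SetAssignment i) (j : Fin (S.size i)) : ℝ :=
  S.orderedDose i (π j)

/-- The observed outcome `R_{ij} = r_{ij}(Z_{ij})`. -/
def observedOutcome (i : Fin S.numSets) (π : S.SetAssignment i) (j : Fin (S.size i)) : ℝ :=
  S.outcome i j (S.assignedDose i π j)

/-- `V_{N,i} = ∑_j ∑_k f_i^{(k)}(Z_{ij}, R_{ij}) 1{Z_{ij} = z_{i(k)}}`. As tied doses are treated as
distinct, the event `Z_{ij} = z_{i(k)}` is that subject `j` receives the `k`-th dose, `π j = k`;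
see `setEstimator_eq_of_injective` for the case without ties. -/
def setEstimator (i : Fin S.numSets) (π : S.SetAssignment i) : ℝ :=
  ∑ j, ∑ k, S.contrast i k (S.assignedDose i π j) (S.observedOutcome i π j) *
    (if π j = k then 1 else 0)

open Classical in
/-- Without ties, the indicator in `setEstimator` is that of the equality of the doses. -/
theorem setEstimator_eq_of_injective (i : Fin S.numSets) (h : Function.Injective (S.dose i))
    (π : S.SetAssignment i) :
    S.setEstimator i π =
      ∑ j, ∑ k, S.contrast i k (S.assignedDose i π j) (S.observedOutcome i π j) *
        (if S.assignedDose i π j = S.orderedDose i k then 1 else 0) := by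
  have key : ∀ j k, (S.assignedDose i π j = S.orderedDose i k) ↔ π j = k := fun j k => by
    simp [assignedDose, orderedDose, h.eq_iff]
  simp only [setEstimator, key]

/-- `V_N = ∑_i (n_i / N) V_{N,i}`. -/
def estimator (π : S.Assignment) : ℝ :=
  ∑ i, (S.size i : ℝ) / (S.total : ℝ) * S.setEstimator i (π i)

/-- The hat matrix `H_Q = Q (Qᵀ Q)⁻¹ Qᵀ`. -/
def hatMatrix {I L : ℕ} (Q : Matrix (Fin I) (Fin L) ℝ) : Matrix (Fin I) (Fin I) ℝ :=
  Q * (Q.transpose * Q)⁻¹ * Q.transpose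

/-- `y_i = V_{N,i} / √(1 - h_{Q,ii})`. -/
def adjusted {L : ℕ} (Q : Matrix (Fin S.numSets) (Fin L) ℝ) (π : S.Assignment)
    (i : Fin S.numSets) : ℝ :=
  S.setEstimator i (π i) / √(1 - hatMatrix Q i i)

/-- The diagonal matrix `W` with entries `w_i = I n_i / N`. -/
def weightMatrix : Matrix (Fin S.numSets) (Fin S.numSets) ℝ :=
  Matrix.diagonal fun i => (S.numSets : ℝ) * (S.size i : ℝ) / (S.total : ℝ)

/-- The variance estimator `S_N²(Q) = I⁻² y W (1 - H_Q) W yᵀ`. -/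
def varianceEstimator {L : ℕ} (Q : Matrix (Fin S.numSets) (Fin L) ℝ) (π : S.Assignment) : ℝ :=
  ((S.numSets : ℝ) ^ 2)⁻¹ *
    (S.adjusted Q π ⬝ᵥ
      Matrix.mulVec (S.weightMatrix * (1 - hatMatrix Q) * S.weightMatrix) (S.adjusted Q π))

/-- The standard normal quantile `Φ⁻¹(p)`, for `0 < p < 1`. -/
def normalQuantile (p : ℝ) : ℝ := sInf {x : ℝ | p ≤ cdf (gaussianReal 0 1) x}

/-- The interval `[V_N - Φ⁻¹(1 - α/2) S_N(Q), V_N + Φ⁻¹(1 - α/2) S_N(Q)]`. -/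
def confidenceInterval {L : ℕ} (Q : Matrix (Fin S.numSets) (Fin L) ℝ) (α : ℝ)
    (π : S.Assignment) : Set ℝ :=
  Set.Icc (S.estimator π - normalQuantile (1 - α / 2) * √(S.varianceEstimator Q π))
    (S.estimator π + normalQuantile (1 - α / 2) * √(S.varianceEstimator Q π))

/-- The random assignment `A` is independent across matched sets and, in each set, uniform over the
`n_i!` permutations (no unmeasured confounding). Sets of permutations are all measurable. -/
structure RandomAssignment {Ω : Type*} [MeasurableSpace Ω] (P : Measure Ω)
    (A : (i : Fin S.numSets) → Ω → S.SetAssignment i) : Prop where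
  measurable : ∀ i, @Measurable Ω (S.SetAssignment i) _ ⊤ (A i)
  independent : iIndepFun (m := fun _ => ⊤) A P
  uniform : ∀ i (σ : S.SetAssignment i), P.real {ω | A i ω = σ} = 1 / ((S.size i)! : ℝ)

/-- The deviation `n_i (V_{N,i} - θ_i)` contributed by set `i` to `N (V_N - θ)`. -/
def deviation (i : Fin S.numSets) (π : S.SetAssignment i) : ℝ :=
  (S.size i : ℝ) * (S.setEstimator i π - S.setEstimand i)

/-- `B² = ∑_i (n_i!)⁻¹ ∑_π (n_i (V_{N,i}(π) - θ_i))²`. -/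
def scaleSq : ℝ := ∑ i, ((S.size i)! : ℝ)⁻¹ * ∑ π, S.deviation i π ^ 2

open Classical in
/-- `∑_i (n_i!)⁻¹ ∑_π (n_i (V_{N,i}(π) - θ_i))² 1{|n_i (V_{N,i}(π) - θ_i)| > ε B}`. -/
def truncatedSq (ε : ℝ) : ℝ :=
  ∑ i, ((S.size i)! : ℝ)⁻¹ *
    ∑ π, if ε * √S.scaleSq < |S.deviation i π| then S.deviation i π ^ 2 else 0

/-- Lindeberg's condition for a sequence of studies: for every `ε > 0`, the deviations larger than
`ε B` contribute a vanishing fraction of `B²`. -/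
def Lindeberg (T : ℕ → DoseStudy) : Prop :=
  ∀ ε : ℝ, 0 < ε → ∀ δ : ℝ, 0 < δ →
    ∀ᶠ m in atTop, (T m).truncatedSq ε ≤ δ * (T m).scaleSq

end DoseStudy

end

namespace Matrix

variable {ι : Type*} [Fintype ι]

/-- An orthogonal projection, as a real matrix. -/
structure IsProjection (p : Matrix ι ι ℝ) : Prop where
  symm : ∀ i j, p i j = p j i
  idem : p * p = p

/-- The projection `p` rescaled on both sides so as to have unit diagonal. -/
noncomputable def diagNormalized (p : Matrix ι ι ℝ) : Matrix ι ι ℝ :=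
  fun i j => p i j / (√(p i i) * √(p j j))

namespace IsProjection

variable {p : Matrix ι ι ℝ} (hp : p.IsProjection)
include hp

theorem sum_apply_mul_apply (i j : ι) : ∑ k, p i k * p j k = p i j := by
  conv_rhs => rw [← hp.idem, mul_apply]
  exact Finset.sum_congr rfl fun k _ => by rw [hp.symm j k]

theorem sum_sq_apply (i : ι) : ∑ k, p i k ^ 2 = p i i := by
  simpa only [sq] using hp.sum_apply_mul_apply i i

theorem sq_apply_le (i j : ι) : p i j ^ 2 ≤ p i i * p j j := by
  rw [← hp.sum_sq_apply i, ← hp.sum_sq_apply j, ← hp.sum_apply_mul_apply i j]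
  exact Finset.sum_mul_sq_le_sq_mul_sq _ _ _

theorem mulVec_mulVec (v : ι → ℝ) : p *ᵥ (p *ᵥ v) = p *ᵥ v := by
  rw [Matrix.mulVec_mulVec, hp.idem]

theorem dotProduct_mulVec_self (v : ι → ℝ) : v ⬝ᵥ (p *ᵥ v) = ∑ i, (p *ᵥ v) i ^ 2 := by
  have hT : pᵀ = p := by ext i j; exact hp.symm j i
  rw [← hp.mulVec_mulVec, dotProduct_mulVec, ← mulVec_transpose, hT, hp.mulVec_mulVec]
  simp only [dotProduct, sq]

theorem sq_mulVec_le (v : ι → ℝ) (i : ι) : (p *ᵥ v) i ^ 2 ≤ p i i * (v ⬝ᵥ (p *ᵥ v)) := by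
  rw [hp.dotProduct_mulVec_self, ← hp.sum_sq_apply i]
  conv_lhs => rw [← hp.mulVec_mulVec]
  exact Finset.sum_mul_sq_le_sq_mul_sq _ _ _

theorem diagNormalized_symm (i j : ι) : p.diagNormalized i j = p.diagNormalized j i := by
  rw [diagNormalized, diagNormalized, hp.symm i j, mul_comm]

omit hp in
theorem _root_.Matrix.diagNormalized_self (hpos : ∀ i, 0 < p i i) (i : ι) :
    p.diagNormalized i i = 1 := by
  rw [diagNormalized, Real.mul_self_sqrt (hpos i).le, div_self (hpos i).ne']

omit hp in
theorem _root_.Matrix.sq_diagNormalized (hpos : ∀ i, 0 < p i i) (i j : ι) :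
    p.diagNormalized i j ^ 2 = p i j ^ 2 / (p i i * p j j) := by
  rw [diagNormalized, div_pow, mul_pow, Real.sq_sqrt (hpos i).le, Real.sq_sqrt (hpos j).le]

theorem sq_diagNormalized_le_one (hpos : ∀ i, 0 < p i i) (i j : ι) :
    p.diagNormalized i j ^ 2 ≤ 1 := by
  rw [sq_diagNormalized hpos]
  exact div_le_one_of_le₀ (hp.sq_apply_le i j) (mul_pos (hpos i) (hpos j)).le

theorem sum_sq_diagNormalized_mul (hpos : ∀ i, 0 < p i i) (i : ι) :
    ∑ j, p.diagNormalized i j ^ 2 * p j j = 1 := by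
  have : ∀ j, p.diagNormalized i j ^ 2 * p j j = p i j ^ 2 / p i i := fun j => by
    rw [sq_diagNormalized hpos]
    field_simp [(hpos j).ne', (hpos i).ne']
  simp only [this]
  rw [← Finset.sum_div, hp.sum_sq_apply, div_self (hpos i).ne']

omit hp in
theorem _root_.Matrix.mulVec_diagNormalized (v : ι → ℝ) (i : ι) :
    (p.diagNormalized *ᵥ v) i = (p *ᵥ fun j => v j / √(p j j)) i / √(p i i) := by
  simp only [mulVec, dotProduct, diagNormalized, Finset.sum_div]
  refine Finset.sum_congr rfl fun j _ => ?_
  rw [div_mul_eq_mul_div, mul_div_assoc, mul_div_assoc, div_div, mul_comm √(p i i)]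

omit hp in
theorem _root_.Matrix.dotProduct_diagNormalized (v : ι → ℝ) :
    v ⬝ᵥ (p.diagNormalized *ᵥ v) =
      (fun j => v j / √(p j j)) ⬝ᵥ (p *ᵥ fun j => v j / √(p j j)) := by
  simp only [dotProduct, mulVec_diagNormalized]
  exact Finset.sum_congr rfl fun i _ => by ring

theorem dotProduct_diagNormalized_nonneg (v : ι → ℝ) :
    0 ≤ v ⬝ᵥ (p.diagNormalized *ᵥ v) := by
  rw [dotProduct_diagNormalized, hp.dotProduct_mulVec_self]
  positivity

theorem sq_mulVec_diagNormalized_le (hpos : ∀ i, 0 < p i i) (v : ι → ℝ) (i : ι) :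
    (p.diagNormalized *ᵥ v) i ^ 2 ≤ v ⬝ᵥ (p.diagNormalized *ᵥ v) := by
  rw [dotProduct_diagNormalized, mulVec_diagNormalized, div_pow, Real.sq_sqrt (hpos i).le,
    div_le_iff₀' (hpos i)]
  exact hp.sq_mulVec_le _ i

theorem sum_sq_mulVec_diagNormalized_mul (hpos : ∀ i, 0 < p i i) (v : ι → ℝ) :
    ∑ i, (p.diagNormalized *ᵥ v) i ^ 2 * p i i = v ⬝ᵥ (p.diagNormalized *ᵥ v) := by
  rw [dotProduct_diagNormalized, hp.dotProduct_mulVec_self]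
  refine Finset.sum_congr rfl fun i _ => ?_
  rw [mulVec_diagNormalized, div_pow, Real.sq_sqrt (hpos i).le, div_mul_cancel₀ _ (hpos i).ne']

end IsProjection

end Matrix

/-- If at most `K` of the positive weights `w i` are below `r`, then nonnegative numbers `g i ≤ c`
with `∑ i, g i * w i ≤ c` have a sum of order `c`. -/
theorem sum_le_of_few_small_weights {ι : Type*} [Fintype ι] {g w : ι → ℝ} {c r : ℝ} {K : ℕ}
    (hr : 0 < r) (hw : ∀ i, 0 ≤ w i) (hK : {i | w i < r}.ncard ≤ K)
    (hc : 0 ≤ c) (hg : ∀ i, 0 ≤ g i) (hgc : ∀ i, g i ≤ c) (hsum : ∑ i, g i * w i ≤ c) :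
    ∑ i, g i ≤ (K + r⁻¹) * c := by
  classical
  have h1 : ∀ i, g i ≤ (if w i < r then c else 0) + r⁻¹ * (g i * w i) := fun i => by
    split_ifs with h
    · have := mul_nonneg (inv_nonneg.2 hr.le) (mul_nonneg (hg i) (hw i))
      linarith [hgc i]
    · rw [zero_add, inv_mul_eq_div, le_div_iff₀ hr]
      exact mul_le_mul_of_nonneg_left (not_lt.1 h) (hg i)
  calc ∑ i, g i ≤ ∑ i, ((if w i < r then c else 0) + r⁻¹ * (g i * w i)) :=
        Finset.sum_le_sum fun i _ => h1 i
    _ = {i | w i < r}.ncard * c + r⁻¹ * ∑ i, g i * w i := by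
        rw [Finset.sum_add_distrib, ← Finset.mul_sum, ← Finset.sum_filter, Finset.sum_const,
          nsmul_eq_mul, Set.ncard_eq_toFinset_card']
        simp
    _ ≤ K * c + r⁻¹ * c := by gcongr
    _ = (K + r⁻¹) * c := by ring

namespace DoseStudy

variable {I L : ℕ} {Q : Matrix (Fin I) (Fin L) ℝ}

theorem isProjection_one_sub_hatMatrix (hQ : IsUnit (Q.transpose * Q)) :
    (1 - hatMatrix Q).IsProjection := by
  have hT : (hatMatrix Q).transpose = hatMatrix Q := by
    simp [hatMatrix, Matrix.transpose_mul, Matrix.transpose_nonsing_inv, Matrix.mul_assoc]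
  have hI : hatMatrix Q * hatMatrix Q = hatMatrix Q := by
    have hdet := (Matrix.isUnit_iff_isUnit_det _).1 hQ
    calc hatMatrix Q * hatMatrix Q
        = Q * ((Q.transpose * Q)⁻¹ * (Q.transpose * Q)) * (Q.transpose * Q)⁻¹ * Q.transpose := by
          simp only [hatMatrix, Matrix.mul_assoc]
      _ = hatMatrix Q := by rw [Matrix.nonsing_inv_mul _ hdet, Matrix.mul_one, hatMatrix]
  refine ⟨fun i j => ?_, ?_⟩
  · have : (1 - hatMatrix Q).transpose = 1 - hatMatrix Q := by
      rw [Matrix.transpose_sub, hT, Matrix.transpose_one]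
    exact (congrFun (congrFun this i) j).symm
  · rw [Matrix.sub_mul, Matrix.one_mul, Matrix.mul_sub, hI, Matrix.mul_one, sub_self, sub_zero]

end DoseStudy

section CharFun

theorem Complex.norm_exp_mul_I_sub_quadratic_le (x : ℝ) :
    ‖Complex.exp (x * Complex.I) - (1 + x * Complex.I - (x : ℂ) ^ 2 / 2)‖ ≤
      4 * x ^ 2 * min 1 |x| := by
  have hn : ‖(x : ℂ) * Complex.I‖ = |x| := by simp
  rcases le_or_gt |x| 1 with h | h
  · rw [min_eq_right h]
    have hb := Complex.exp_bound (x := x * Complex.I) (hn.trans_le h) (n := 3) (by norm_num)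
    have hs : ∑ m ∈ Finset.range 3, ((x : ℂ) * Complex.I) ^ m / (m ! : ℂ) =
        1 + x * Complex.I - (x : ℂ) ^ 2 / 2 := by
      simp [Finset.sum_range_succ, Nat.factorial, mul_pow, Complex.I_sq]
      ring
    rw [hs, hn] at hb
    refine hb.trans ?_
    have h3 : |x| ^ 3 = x ^ 2 * |x| := by rw [← sq_abs x]; ring
    have : 0 ≤ x ^ 2 * |x| := by positivity
    rw [h3]
    norm_num [Nat.factorial]
    linarith
  · rw [min_eq_left h.le]
    have hx2 : |x| ≤ x ^ 2 := by rw [← sq_abs x]; nlinarith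
    calc ‖Complex.exp (x * Complex.I) - (1 + x * Complex.I - (x : ℂ) ^ 2 / 2)‖
        ≤ ‖Complex.exp (x * Complex.I)‖ + ((‖(1 : ℂ)‖ + ‖(x : ℂ) * Complex.I‖) +
            ‖(x : ℂ) ^ 2 / 2‖) :=
          (norm_sub_le _ _).trans (add_le_add le_rfl ((norm_sub_le _ _).trans
            (add_le_add (norm_add_le _ _) le_rfl)))
      _ = 2 + |x| + x ^ 2 / 2 := by
          rw [Complex.norm_exp_ofReal_mul_I, hn]
          simp
          ring
      _ ≤ 4 * x ^ 2 * 1 := by nlinarith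

theorem Complex.norm_exp_mul_I_sub_quadratic_le_of_pos (t x : ℝ) {ε : ℝ} (hε : 0 < ε) :
    ‖Complex.exp (t * x * Complex.I) - (1 + t * x * Complex.I - (t * x : ℂ) ^ 2 / 2)‖ ≤
      4 * |t| ^ 3 * ε * x ^ 2 + 4 * t ^ 2 * (if ε < |x| then x ^ 2 else 0) := by
  have h := Complex.norm_exp_mul_I_sub_quadratic_le (t * x)
  push_cast at h
  refine h.trans ?_
  have ht : 0 ≤ |t| := abs_nonneg t
  split_ifs with hx
  · have : 4 * (t * x) ^ 2 * min 1 |t * x| ≤ 4 * (t * x) ^ 2 * 1 := by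
      gcongr; exact min_le_left _ _
    have : 0 ≤ 4 * |t| ^ 3 * ε * x ^ 2 := by positivity
    nlinarith
  · have h1 : 4 * (t * x) ^ 2 * min 1 |t * x| ≤ 4 * (t * x) ^ 2 * (|t| * ε) := by
      gcongr
      rw [abs_mul]
      exact (min_le_right _ _).trans (mul_le_mul_of_nonneg_left (not_lt.1 hx) ht)
    have h3 : |t| ^ 3 = t ^ 2 * |t| := by rw [← sq_abs t]; ring
    rw [h3]
    nlinarith

theorem norm_prod_sub_prod_le_sum {ι : Type*} (s : Finset ι) {a b : ι → ℂ}
    (ha : ∀ i, ‖a i‖ ≤ 1) (hb : ∀ i, ‖b i‖ ≤ 1) :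
    ‖∏ i ∈ s, a i - ∏ i ∈ s, b i‖ ≤ ∑ i ∈ s, ‖a i - b i‖ := by
  classical
  induction s using Finset.induction_on with
  | empty => simp
  | insert j s hj ih =>
    rw [Finset.prod_insert hj, Finset.prod_insert hj, Finset.sum_insert hj]
    have hB : ‖∏ i ∈ s, b i‖ ≤ 1 := by
      rw [norm_prod]
      exact Finset.prod_le_one (fun i _ => norm_nonneg _) fun i _ => hb i
    calc ‖a j * ∏ i ∈ s, a i - b j * ∏ i ∈ s, b i‖
        = ‖(a j - b j) * ∏ i ∈ s, b i + a j * (∏ i ∈ s, a i - ∏ i ∈ s, b i)‖ := by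
          congr 1; ring
      _ ≤ ‖a j - b j‖ * ‖∏ i ∈ s, b i‖ + ‖a j‖ * ‖∏ i ∈ s, a i - ∏ i ∈ s, b i‖ := by
          rw [← norm_mul, ← norm_mul]; exact norm_add_le _ _
      _ ≤ ‖a j - b j‖ * 1 + 1 * ∑ i ∈ s, ‖a i - b i‖ := by
          gcongr
          exact ha j
      _ = _ := by ring

theorem abs_one_sub_sub_exp_neg_le {s : ℝ} (hs : 0 ≤ s) : |1 - s - Real.exp (-s)| ≤ s ^ 2 := by
  have h1 := Real.add_one_le_exp (-s)
  rw [abs_of_nonpos (by linarith)]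
  have h3 : Real.exp (-s) * (1 + s) ≤ 1 := by
    have := Real.add_one_le_exp s
    calc Real.exp (-s) * (1 + s) ≤ Real.exp (-s) * Real.exp s := by
          gcongr; linarith
      _ = 1 := by rw [← Real.exp_add]; simp
  have : 0 < Real.exp (-s) := Real.exp_pos _
  rcases le_or_gt s 1 with h | h
  · have h4 : 1 ≤ (1 - s + s ^ 2) * (1 + s) := by nlinarith [pow_nonneg hs 3]
    have : Real.exp (-s) ≤ 1 - s + s ^ 2 := by
      by_contra hc
      push Not at hc
      nlinarith
    linarith
  · nlinarith

end CharFun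

/-- Finitely many bounded, independent, centered random variables. -/
structure CenteredIndep {ι Ω : Type*} [MeasurableSpace Ω] (X : ι → Ω → ℝ) (P : Measure Ω) :
    Prop where
  measurable : ∀ i, Measurable (X i)
  bounded : ∃ C, ∀ i ω, |X i ω| ≤ C
  indep : iIndepFun X P
  mean : ∀ i, ∫ ω, X i ω ∂P = 0

/-- The truncated second moments `∑ i, E[X i ^ 2; |X i| > ε]` in Lindeberg's condition. -/
noncomputable def lindebergSum {ι Ω : Type*} [Fintype ι] [MeasurableSpace Ω] (X : ι → Ω → ℝ)
    (P : Measure Ω) (ε : ℝ) : ℝ :=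
  ∑ i, ∫ ω, (if ε < |X i ω| then X i ω ^ 2 else 0) ∂P

namespace CenteredIndep

variable {ι Ω : Type*} [Fintype ι] [MeasurableSpace Ω] {X : ι → Ω → ℝ} {P : Measure Ω}
  [IsProbabilityMeasure P] (hX : CenteredIndep X P)
include hX

theorem integrable_comp {F : (ι → ℝ) → ℝ} (hF : Continuous F) :
    Integrable (fun ω => F fun i => X i ω) P := by
  obtain ⟨C, hC⟩ := hX.bounded
  obtain ⟨M, hM⟩ := (isCompact_univ_pi fun _ : ι => isCompact_Icc (a := -C) (b := C)).exists_bound_of_continuousOn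
    hF.continuousOn
  refine Integrable.of_bound (hF.measurable.comp
    (measurable_pi_lambda _ hX.measurable)).aestronglyMeasurable M (ae_of_all _ fun ω => ?_)
  exact hM _ fun i _ => abs_le.1 (hC i ω)

theorem integrable_truncated (i : ι) (ε : ℝ) :
    Integrable (fun ω => if ε < |X i ω| then X i ω ^ 2 else 0) P := by
  refine (hX.integrable_comp (F := fun x => x i ^ 2) (by fun_prop)).mono' ?_
    (ae_of_all _ fun ω => ?_)
  · exact (Measurable.ite (measurableSet_lt measurable_const (hX.measurable i).abs)
      ((hX.measurable i).pow_const 2) measurable_const).aestronglyMeasurable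
  · split_ifs
    · rw [Real.norm_of_nonneg (sq_nonneg _)]
    · simpa using sq_nonneg _

omit hX in
theorem _root_.lindebergSum_nonneg (ε : ℝ) : 0 ≤ lindebergSum X P ε :=
  Finset.sum_nonneg fun i _ => integral_nonneg fun ω => by
    dsimp only; split_ifs <;> positivity

theorem secondMoment_le (i : ι) (ε : ℝ) :
    ∫ ω, X i ω ^ 2 ∂P ≤ ε ^ 2 + lindebergSum X P ε := by
  have h1 : ∫ ω, X i ω ^ 2 ∂P ≤
      ∫ ω, (ε ^ 2 + if ε < |X i ω| then X i ω ^ 2 else 0) ∂P := by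
    refine integral_mono (hX.integrable_comp (F := fun x => x i ^ 2) (by fun_prop))
      ((integrable_const _).add (hX.integrable_truncated i ε)) fun ω => ?_
    dsimp only
    split_ifs with h
    · nlinarith
    · rw [add_zero]
      exact sq_le_sq' (by linarith [neg_abs_le (X i ω)]) ((le_abs_self _).trans (not_lt.1 h))
  rw [integral_add (integrable_const _) (hX.integrable_truncated i ε)] at h1
  simp only [integral_const, probReal_univ, one_smul] at h1
  refine h1.trans (add_le_add le_rfl ?_)
  exact Finset.single_le_sum (f := fun i => ∫ ω, (if ε < |X i ω| then X i ω ^ 2 else 0) ∂P)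
    (fun i _ => integral_nonneg fun ω => by dsimp only; split_ifs <;> positivity)
    (Finset.mem_univ i)

theorem norm_charFun_map_sub_le (i : ι) (t : ℝ) {ε : ℝ} (hε : 0 < ε) :
    ‖charFun (P.map (X i)) t - (1 - (t ^ 2 * (∫ ω, X i ω ^ 2 ∂P) / 2 : ℝ))‖ ≤
      4 * |t| ^ 3 * ε * ∫ ω, X i ω ^ 2 ∂P +
        4 * t ^ 2 * ∫ ω, (if ε < |X i ω| then X i ω ^ 2 else 0) ∂P := by
  have i1 : Integrable (fun ω => X i ω) P := hX.integrable_comp (F := fun x => x i) (by fun_prop)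
  have i2 : Integrable (fun ω => X i ω ^ 2) P :=
    hX.integrable_comp (F := fun x => x i ^ 2) (by fun_prop)
  have ie : Integrable (fun ω => Complex.exp (t * X i ω * Complex.I)) P := by
    refine Integrable.of_bound (C := 1) ?_ (ae_of_all _ fun ω => ?_)
    · have := hX.measurable i
      exact (by fun_prop : Measurable _).aestronglyMeasurable
    · rw [← Complex.ofReal_mul, Complex.norm_exp_ofReal_mul_I]
  have a1 : Integrable (fun ω => (t * X i ω * Complex.I : ℂ)) P :=
    (i1.ofReal.const_mul (t : ℂ)).mul_const _
  have a2 : Integrable (fun ω => ((t * X i ω : ℂ) ^ 2 / 2)) P := by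
    simpa [mul_pow] using (i2.ofReal (𝕜 := ℂ).const_mul ((t : ℂ) ^ 2)).div_const 2
  have a3 : Integrable (fun ω => (1 + t * X i ω * Complex.I : ℂ)) P := (integrable_const _).add a1
  have iq : Integrable (fun ω => (1 + t * X i ω * Complex.I - (t * X i ω : ℂ) ^ 2 / 2 : ℂ)) P :=
    a3.sub a2
  have hq : ∫ ω, (1 + t * X i ω * Complex.I - (t * X i ω : ℂ) ^ 2 / 2 : ℂ) ∂P =
      1 - (t ^ 2 * (∫ ω, X i ω ^ 2 ∂P) / 2 : ℝ) := by
    rw [integral_sub a3 a2, integral_add (integrable_const _) a1,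
      integral_mul_const, integral_const_mul, integral_div]
    simp only [mul_pow, integral_const_mul, integral_const, probReal_univ, one_smul]
    have e2 : ∫ ω, (X i ω : ℂ) ^ 2 ∂P = ((∫ ω, X i ω ^ 2 ∂P : ℝ) : ℂ) := by
      rw [← integral_complex_ofReal]; simp
    rw [integral_complex_ofReal, hX.mean i, e2]
    push_cast
    ring
  rw [charFun_apply_real, integral_map (hX.measurable i).aemeasurable
    (by fun_prop : Measurable fun x : ℝ => Complex.exp (t * x * Complex.I)).aestronglyMeasurable,
    ← hq, ← integral_sub ie iq,
    ← integral_const_mul, ← integral_const_mul,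
    ← integral_add (i2.const_mul _) ((hX.integrable_truncated i ε).const_mul _)]
  exact norm_integral_le_of_norm_le ((i2.const_mul _).add ((hX.integrable_truncated i ε).const_mul _))
    (ae_of_all _ fun ω => Complex.norm_exp_mul_I_sub_quadratic_le_of_pos t (X i ω) hε)

theorem norm_charFun_map_sum_sub_le (hvar : ∑ i, ∫ ω, X i ω ^ 2 ∂P = 1) (t : ℝ) {ε : ℝ}
    (hε : 0 < ε) :
    ‖charFun (P.map fun ω => ∑ i, X i ω) t - charFun (gaussianReal 0 1) t‖ ≤
      4 * |t| ^ 3 * ε + 4 * t ^ 2 * lindebergSum X P ε +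
        t ^ 4 * (ε ^ 2 + lindebergSum X P ε) := by
  have hs0 : ∀ i, 0 ≤ ∫ ω, X i ω ^ 2 ∂P := fun i => integral_nonneg fun ω => sq_nonneg _
  set s : ι → ℝ := fun i => ∫ ω, X i ω ^ 2 ∂P with hs
  have hg : charFun (gaussianReal 0 1) t = ∏ i, ((Real.exp (-(t ^ 2 * s i / 2)) : ℝ) : ℂ) := by
    rw [← Complex.ofReal_prod, ← Real.exp_sum, Finset.sum_neg_distrib, ← Finset.sum_div,
      ← Finset.mul_sum, hvar, charFun_gaussianReal]
    push_cast
    congr 1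
    simp
  have hpm : ∀ i, IsProbabilityMeasure (P.map (X i)) := fun i =>
    Measure.isProbabilityMeasure_map (hX.measurable i).aemeasurable
  rw [hX.indep.charFun_map_fun_sum_eq_prod fun i => (hX.measurable i).aemeasurable, hg,
    Finset.prod_apply]
  refine (norm_prod_sub_prod_le_sum _ (fun i => norm_charFun_le_one _) fun i => ?_).trans ?_
  · rw [Complex.norm_real, Real.norm_of_nonneg (Real.exp_pos _).le]
    exact Real.exp_le_one_iff.2 (by have := hs0 i; simp only [hs]; nlinarith [sq_nonneg t])
  · have hterm : ∀ i, ‖charFun (P.map (X i)) t - ((Real.exp (-(t ^ 2 * s i / 2)) : ℝ) : ℂ)‖ ≤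
        4 * |t| ^ 3 * ε * s i +
        4 * t ^ 2 * ∫ ω, (if ε < |X i ω| then X i ω ^ 2 else 0) ∂P +
        t ^ 4 * (ε ^ 2 + lindebergSum X P ε) * s i := fun i => by
      have h1 := hX.norm_charFun_map_sub_le i t hε
      have h2 : ‖(1 - (t ^ 2 * s i / 2 : ℝ) : ℂ) - ((Real.exp (-(t ^ 2 * s i / 2)) : ℝ) : ℂ)‖ ≤
          t ^ 4 * (ε ^ 2 + lindebergSum X P ε) * s i := by
        have hnn : 0 ≤ t ^ 2 * s i / 2 := by have := hs0 i; simp only [hs]; positivity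
        rw [← Complex.ofReal_one, ← Complex.ofReal_sub, ← Complex.ofReal_sub, Complex.norm_real]
        refine (abs_one_sub_sub_exp_neg_le hnn).trans ?_
        have h3 : s i * s i ≤ (ε ^ 2 + lindebergSum X P ε) * s i :=
          mul_le_mul_of_nonneg_right (hX.secondMoment_le i ε) (hs0 i)
        have h4 : 0 ≤ s i * s i := mul_self_nonneg _
        have h5 : t ^ 4 * (s i * s i) ≤ t ^ 4 * ((ε ^ 2 + lindebergSum X P ε) * s i) := by
          gcongr
        have h6 : 0 ≤ t ^ 4 * (s i * s i) := by positivity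
        nlinarith
      calc _ ≤ _ := norm_sub_le_norm_sub_add_norm_sub _ (1 - (t ^ 2 * s i / 2 : ℝ) : ℂ) _
        _ ≤ _ := add_le_add h1 h2
    refine (Finset.sum_le_sum fun i _ => hterm i).trans_eq ?_
    rw [Finset.sum_add_distrib, Finset.sum_add_distrib, ← Finset.mul_sum, ← Finset.mul_sum,
      ← Finset.mul_sum, hvar, lindebergSum]
    ring

end CenteredIndep

theorem measureReal_le_of_le_sq {Ω : Type*} [MeasurableSpace Ω] {P : Measure Ω}
    [IsFiniteMeasure P] {Z : Ω → ℝ} {s : Set Ω} {δ v : ℝ} (hδ : 0 < δ)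
    (hZ : Integrable (fun ω => Z ω ^ 2) P) (hv : ∫ ω, Z ω ^ 2 ∂P ≤ v)
    (hs : ∀ ω ∈ s, δ ≤ |Z ω|) : P.real s ≤ v / δ ^ 2 := by
  rw [le_div_iff₀' (by positivity)]
  refine le_trans ?_ hv
  refine le_trans ?_ (mul_meas_ge_le_integral_of_nonneg (ae_of_all _ fun ω => sq_nonneg _) hZ (δ ^ 2))
  refine mul_le_mul_of_nonneg_left (measureReal_mono fun ω hω => ?_) (sq_nonneg _)
  have := hs ω hω
  simp only [Set.mem_ofPred_eq]
  rw [← sq_abs (Z ω)]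
  gcongr

theorem integral_add_add {Ω : Type*} [MeasurableSpace Ω] {P : Measure Ω} {f g h : Ω → ℝ}
    (hf : Integrable f P) (hg : Integrable g P) (hh : Integrable h P) :
    ∫ ω, (f ω + g ω + h ω) ∂P = ∫ ω, f ω ∂P + ∫ ω, g ω ∂P + ∫ ω, h ω ∂P := by
  rw [← integral_add hf hg]
  exact integral_add (hf.add hg) hh

namespace CenteredIndep

variable {ι Ω : Type*} [Fintype ι] [MeasurableSpace Ω] {X : ι → Ω → ℝ} {P : Measure Ω}
  [IsProbabilityMeasure P] (hX : CenteredIndep X P)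
include hX

theorem integral_comp_mul_comp (a : ι) {u : ℝ → ℝ} (hu : Continuous u) {F : (ι → ℝ) → ℝ}
    (hF : Continuous F) (hdep : ∀ x y, (∀ i, i ≠ a → x i = y i) → F x = F y) :
    ∫ ω, u (X a ω) * F (fun i => X i ω) ∂P =
      (∫ ω, u (X a ω) ∂P) * ∫ ω, F (fun i => X i ω) ∂P := by
  classical
  have hd : Disjoint {a} (Finset.univ.erase a) := by simp
  let G : ({i // i ∈ Finset.univ.erase a} → ℝ) → ℝ :=
    fun r => F fun i => if h : i ∈ Finset.univ.erase a then r ⟨i, h⟩ else 0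
  have hG : Measurable G := by
    refine hF.measurable.comp (measurable_pi_lambda _ fun i => ?_)
    split_ifs with h
    · exact measurable_pi_apply _
    · exact measurable_const
  have h := (hX.indep.indepFun_finset {a} (Finset.univ.erase a) hd hX.measurable).comp
    (hu.measurable.comp (measurable_pi_apply ⟨a, Finset.mem_singleton_self a⟩)) hG
  have hGF : ∀ ω, G (fun i => X i ω) = F fun i => X i ω := fun ω => by
    refine hdep _ _ fun i hi => ?_
    simp [hi]
  have h' : IndepFun (fun ω => u (X a ω)) (fun ω => F fun i => X i ω) P := by
    convert h using 1
    · rfl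
    · ext ω
      exact (hGF ω).symm
  exact h'.integral_fun_mul_eq_mul_integral
    (hu.measurable.comp (hX.measurable a)).aestronglyMeasurable
    (hF.measurable.comp (measurable_pi_lambda _ hX.measurable)).aestronglyMeasurable

theorem integral_sq_linear (c : ι → ℝ) (s : Finset ι) :
    ∫ ω, (∑ i ∈ s, c i * X i ω) ^ 2 ∂P = ∑ i ∈ s, c i ^ 2 * ∫ ω, X i ω ^ 2 ∂P := by
  classical
  induction s using Finset.induction_on with
  | empty => simp
  | insert a s ha ih =>
    have h0 : ∫ ω, X a ω * ∑ i ∈ s, c i * X i ω ∂P = 0 := by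
      have := hX.integral_comp_mul_comp a (u := id) continuous_id
        (F := fun x => ∑ i ∈ s, c i * x i) (by fun_prop) fun x y hxy =>
          Finset.sum_congr rfl fun i hi => by rw [hxy i (ne_of_mem_of_not_mem hi ha)]
      simpa only [id, hX.mean a, zero_mul] using this
    have e : ∀ ω, (∑ i ∈ insert a s, c i * X i ω) ^ 2 = c a ^ 2 * X a ω ^ 2 +
        2 * c a * (X a ω * ∑ i ∈ s, c i * X i ω) + (∑ i ∈ s, c i * X i ω) ^ 2 := fun ω => by
      rw [Finset.sum_insert ha]; ring
    have i1 : Integrable (fun ω => c a ^ 2 * X a ω ^ 2) P :=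
      hX.integrable_comp (F := fun x => c a ^ 2 * x a ^ 2) (by fun_prop)
    have i2 : Integrable (fun ω => 2 * c a * (X a ω * ∑ i ∈ s, c i * X i ω)) P :=
      hX.integrable_comp (F := fun x => 2 * c a * (x a * ∑ i ∈ s, c i * x i)) (by fun_prop)
    have i3 : Integrable (fun ω => (∑ i ∈ s, c i * X i ω) ^ 2) P :=
      hX.integrable_comp (F := fun x => (∑ i ∈ s, c i * x i) ^ 2) (by fun_prop)
    simp only [e]
    rw [integral_add_add i1 i2 i3, integral_const_mul, integral_const_mul,
      h0, ih, Finset.sum_insert ha]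
    ring

theorem integral_sq_bilinear {m : ι → ι → ℝ} (hsymm : ∀ i j, m i j = m j i)
    (hdiag : ∀ i, m i i = 0) (s : Finset ι) :
    ∫ ω, (∑ i ∈ s, ∑ j ∈ s, m i j * X i ω * X j ω) ^ 2 ∂P =
      2 * ∑ i ∈ s, ∑ j ∈ s, m i j ^ 2 * (∫ ω, X i ω ^ 2 ∂P) * ∫ ω, X j ω ^ 2 ∂P := by
  classical
  have split : ∀ (a : ι) (s : Finset ι) (f : ι → ι → ℝ), a ∉ s → (∀ i j, f i j = f j i) →
      f a a = 0 → ∑ i ∈ insert a s, ∑ j ∈ insert a s, f i j =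
        ∑ i ∈ s, ∑ j ∈ s, f i j + 2 * ∑ j ∈ s, f a j := by
    intro a s f ha hf h0
    rw [Finset.sum_insert ha, Finset.sum_insert ha, h0]
    simp only [Finset.sum_insert ha, Finset.sum_add_distrib]
    rw [Finset.sum_congr rfl fun i _ => hf i a]
    ring
  induction s using Finset.induction_on with
  | empty => simp
  | insert a s ha ih =>
    set R : (ι → ℝ) → ℝ := fun x => ∑ i ∈ s, ∑ j ∈ s, m i j * x i * x j with hR
    set T : (ι → ℝ) → ℝ := fun x => ∑ j ∈ s, m a j * x j with hT
    have cR : Continuous R := by fun_prop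
    have cT : Continuous T := by fun_prop
    have dR : ∀ x y : ι → ℝ, (∀ i, i ≠ a → x i = y i) → R x = R y := fun x y hxy =>
      Finset.sum_congr rfl fun i hi => Finset.sum_congr rfl fun j hj => by
        rw [hxy i (ne_of_mem_of_not_mem hi ha), hxy j (ne_of_mem_of_not_mem hj ha)]
    have dT : ∀ x y : ι → ℝ, (∀ i, i ≠ a → x i = y i) → T x = T y := fun x y hxy =>
      Finset.sum_congr rfl fun i hi => by rw [hxy i (ne_of_mem_of_not_mem hi ha)]
    have h0 : ∫ ω, X a ω * (R (fun i => X i ω) * T fun i => X i ω) ∂P = 0 := by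
      have := hX.integral_comp_mul_comp a (u := id) continuous_id
        (F := fun x => R x * T x) (cR.mul cT) fun x y hxy => by rw [dR x y hxy, dT x y hxy]
      simpa only [id, hX.mean a, zero_mul] using this
    have h2 : ∫ ω, X a ω ^ 2 * T (fun i => X i ω) ^ 2 ∂P =
        (∫ ω, X a ω ^ 2 ∂P) * ∑ j ∈ s, m a j ^ 2 * ∫ ω, X j ω ^ 2 ∂P := by
      rw [← hX.integral_sq_linear (m a) s]
      exact hX.integral_comp_mul_comp a (u := fun x => x ^ 2) (by fun_prop)
        (F := fun x => T x ^ 2) (cT.pow 2) fun x y hxy => by rw [dT x y hxy]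
    have e : ∀ ω, (∑ i ∈ insert a s, ∑ j ∈ insert a s, m i j * X i ω * X j ω) ^ 2 =
        R (fun i => X i ω) ^ 2 + 4 * (X a ω * (R (fun i => X i ω) * T fun i => X i ω)) +
          4 * (X a ω ^ 2 * T (fun i => X i ω) ^ 2) := fun ω => by
      rw [split a s _ ha (fun i j => by rw [hsymm i j]; ring) (by rw [hdiag]; ring)]
      have : ∑ j ∈ s, m a j * X a ω * X j ω = X a ω * T fun i => X i ω := by
        rw [hT, Finset.mul_sum]
        exact Finset.sum_congr rfl fun j _ => by ring
      rw [this]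
      ring
    have i1 : Integrable (fun ω => R (fun i => X i ω) ^ 2) P :=
      hX.integrable_comp (F := fun x => R x ^ 2) (cR.pow 2)
    have i2 : Integrable (fun ω => 4 * (X a ω * (R (fun i => X i ω) * T fun i => X i ω))) P :=
      hX.integrable_comp (F := fun x => 4 * (x a * (R x * T x))) (by fun_prop)
    have i3 : Integrable (fun ω => 4 * (X a ω ^ 2 * T (fun i => X i ω) ^ 2)) P :=
      hX.integrable_comp (F := fun x => 4 * (x a ^ 2 * T x ^ 2)) (by fun_prop)
    simp only [e]
    rw [integral_add_add i1 i2 i3, integral_const_mul, integral_const_mul,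
      h0, h2, ih, split a s _ ha (fun i j => by rw [hsymm i j]; ring) (by rw [hdiag]; ring)]
    have : ∑ j ∈ s, m a j ^ 2 * (∫ ω, X a ω ^ 2 ∂P) * ∫ ω, X j ω ^ 2 ∂P =
        (∫ ω, X a ω ^ 2 ∂P) * ∑ j ∈ s, m a j ^ 2 * ∫ ω, X j ω ^ 2 ∂P := by
      rw [Finset.mul_sum]
      exact Finset.sum_congr rfl fun j _ => by ring
    rw [this]
    ring

/-- The sum of the squares is bounded below in probability. -/
theorem measureReal_sum_sq_lt_le (hvar : ∑ i, ∫ ω, X i ω ^ 2 ∂P = 1) {ε δ : ℝ}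
    (hδ : 0 < δ) (hΛ : lindebergSum X P ε ≤ δ) :
    P.real {ω | ∑ i, X i ω ^ 2 < 1 - 2 * δ} ≤ ε ^ 2 / δ ^ 2 := by
  set g : ℝ → ℝ := fun x => x ^ 2 - if ε < |x| then x ^ 2 else 0 with hg
  have g0 : ∀ x, 0 ≤ g x := fun x => by simp only [hg]; split_ifs <;> nlinarith [sq_nonneg x]
  have gle : ∀ x, g x ≤ x ^ 2 := fun x => by simp only [hg]; split_ifs <;> nlinarith [sq_nonneg x]
  have gε : ∀ x, g x ≤ ε ^ 2 := fun x => by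
    simp only [hg]
    split_ifs with h
    · nlinarith
    · rw [sub_zero]
      exact sq_le_sq' (by linarith [neg_abs_le x]) ((le_abs_self _).trans (not_lt.1 h))
  have gm : Measurable g := (measurable_id.pow_const 2).sub
    (Measurable.ite (measurableSet_lt measurable_const measurable_id.abs)
      (measurable_id.pow_const 2) measurable_const)
  have gi : ∀ i, Integrable (fun ω => g (X i ω)) P := fun i =>
    (hX.integrable_comp (F := fun x => x i ^ 2) (by fun_prop)).sub (hX.integrable_truncated i ε)
  have gi2 : ∀ i, Integrable (fun ω => g (X i ω) ^ 2) P := fun i =>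
    Integrable.of_bound ((gm.comp (hX.measurable i)).pow_const 2).aestronglyMeasurable (ε ^ 2 * ε ^ 2)
      (ae_of_all _ fun ω => by
        rw [Real.norm_of_nonneg (sq_nonneg _), sq (g _)]
        exact mul_le_mul (gε _) (gε _) (g0 _) (sq_nonneg _))
  set e : ι → ℝ := fun i => ∫ ω, g (X i ω) ∂P with he
  have hY : CenteredIndep (fun i ω => g (X i ω) - e i) P := by
    refine ⟨fun i => (gm.comp (hX.measurable i)).sub_const _, ⟨ε ^ 2 + ∑ i, |e i|, fun i ω => ?_⟩,
      hX.indep.comp (fun i x => g x - e i) fun i => gm.sub_const _, fun i => ?_⟩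
    · refine (abs_sub _ _).trans (add_le_add ?_ ?_)
      · rw [abs_of_nonneg (g0 _)]; exact gε _
      · exact Finset.single_le_sum (f := fun i => |e i|) (fun i _ => abs_nonneg _)
          (Finset.mem_univ i)
    · rw [integral_sub (gi i) (integrable_const _)]
      simp [he]
  have hsum : 1 - δ ≤ ∑ i, e i := by
    have : ∀ i, e i = (∫ ω, X i ω ^ 2 ∂P) - ∫ ω, (if ε < |X i ω| then X i ω ^ 2 else 0) ∂P :=
      fun i => integral_sub (hX.integrable_comp (F := fun x => x i ^ 2) (by fun_prop))
        (hX.integrable_truncated i ε)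
    simp only [this]
    rw [Finset.sum_sub_distrib, hvar]
    unfold lindebergSum at hΛ
    linarith
  have hone := hY.integral_sq_linear (fun _ => 1) Finset.univ
  simp only [one_mul, one_pow] at hone
  refine measureReal_le_of_le_sq (Z := fun ω => ∑ i, (g (X i ω) - e i)) hδ
    (hY.integrable_comp (F := fun x => (∑ i, x i) ^ 2) (by fun_prop)) ?_ fun ω hω => ?_
  · rw [hone]
    have hi : ∀ i, ∫ ω, (g (X i ω) - e i) ^ 2 ∂P ≤ ε ^ 2 * ∫ ω, X i ω ^ 2 ∂P := fun i => by
      have e1 : ∀ ω, (g (X i ω) - e i) ^ 2 = g (X i ω) ^ 2 - 2 * e i * g (X i ω) + e i ^ 2 :=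
        fun ω => by ring
      simp only [e1]
      have i1 : Integrable (fun ω => g (X i ω) ^ 2 - 2 * e i * g (X i ω)) P :=
        (gi2 i).sub ((gi i).const_mul _)
      rw [integral_add i1 (integrable_const _), integral_sub (gi2 i) ((gi i).const_mul _), integral_const_mul]
      simp only [integral_const, probReal_univ, one_smul]
      have e2 : ∫ ω, g (X i ω) ^ 2 ∂P ≤ ∫ ω, ε ^ 2 * X i ω ^ 2 ∂P :=
        integral_mono (gi2 i)
          (hX.integrable_comp (F := fun x => ε ^ 2 * x i ^ 2) (by fun_prop)) fun ω => by
          dsimp only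
          rw [sq (g _)]
          exact mul_le_mul (gε _) (gle _) (g0 _) (sq_nonneg _)
      rw [integral_const_mul] at e2
      change _ - 2 * e i * e i + e i ^ 2 ≤ _
      nlinarith [sq_nonneg (e i)]
    refine (Finset.sum_le_sum fun i _ => hi i).trans_eq ?_
    rw [← Finset.mul_sum, hvar, mul_one]
  · have h1 : ∑ i, g (X i ω) ≤ ∑ i, X i ω ^ 2 := Finset.sum_le_sum fun i _ => gle _
    have h2 : ∑ i, X i ω ^ 2 < 1 - 2 * δ := hω
    rw [Finset.sum_sub_distrib, abs_of_neg (by linarith)]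
    linarith

theorem measureReal_quadraticForm_lt_le (hvar : ∑ i, ∫ ω, X i ω ^ 2 ∂P = 1)
    {p : Matrix ι ι ℝ} (hp : p.IsProjection) (hpos : ∀ i, 0 < p i i) {r : ℝ} (hr : 0 < r) {K : ℕ}
    (hK : {i | p i i < r}.ncard ≤ K) (a : ι → ℝ) {ε δ : ℝ} (hδ : 0 < δ)
    (hδ1 : δ < 1) (hΛ : lindebergSum X P ε ≤ δ) :
    P.real {ω | (fun i => a i + X i ω) ⬝ᵥ (p.diagNormalized.mulVec fun i => a i + X i ω) <
        1 - 4 * δ} ≤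
      (ε ^ 2 + 6 * (ε ^ 2 + lindebergSum X P ε) * (K + r⁻¹)) / δ ^ 2 := by
  classical
  set n := p.diagNormalized with hn
  set b := a ⬝ᵥ (n.mulVec a) with hb
  set τ := ε ^ 2 + lindebergSum X P ε with hτ
  set C : ℝ := K + r⁻¹ with hC
  have hb0 : 0 ≤ b := hp.dotProduct_diagNormalized_nonneg a
  have hτ0 : 0 ≤ τ := add_nonneg (sq_nonneg _) (lindebergSum_nonneg _)
  have hC0 : 0 ≤ C := by positivity
  have hs0 : ∀ i, 0 ≤ ∫ ω, X i ω ^ 2 ∂P := fun i => integral_nonneg fun ω => sq_nonneg _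
  have hsτ : ∀ i, ∫ ω, X i ω ^ 2 ∂P ≤ τ := fun i => hX.secondMoment_le i ε
  set m : ι → ι → ℝ := fun i j => if i = j then 0 else n i j with hm
  have msymm : ∀ i j, m i j = m j i := fun i j => by
    simp only [hm, eq_comm (a := i), hn, hp.diagNormalized_symm i j]
  have mdiag : ∀ i, m i i = 0 := fun i => by simp [hm]
  have msq : ∀ i j, m i j ^ 2 ≤ n i j ^ 2 := fun i j => by
    simp only [hm]; split_ifs
    · rw [zero_pow two_ne_zero]; positivity
    · exact le_rfl
  have hrow : ∀ i, ∑ j, n i j ^ 2 ≤ C * 1 := fun i =>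
    sum_le_of_few_small_weights hr (fun j => (hpos j).le) hK zero_le_one
      (fun j => sq_nonneg _) (fun j => hp.sq_diagNormalized_le_one hpos i j)
      (hp.sum_sq_diagNormalized_mul hpos i).le
  have hlin : ∑ i, (n.mulVec a) i ^ 2 ≤ C * b :=
    sum_le_of_few_small_weights hr (fun j => (hpos j).le) hK hb0
      (fun j => sq_nonneg _) (fun j => hp.sq_mulVec_diagNormalized_le hpos a j)
      (hp.sum_sq_mulVec_diagNormalized_mul hpos a).le
  have decomp : ∀ ω, (fun i => a i + X i ω) ⬝ᵥ (n.mulVec fun i => a i + X i ω) =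
      b + 2 * ∑ i, (n.mulVec a) i * X i ω + ∑ i, X i ω ^ 2 +
        ∑ i, ∑ j, m i j * X i ω * X j ω := fun ω => by
    have e1 : ∑ i, X i ω ^ 2 + ∑ i, ∑ j, m i j * X i ω * X j ω =
        ∑ i, ∑ j, n i j * X i ω * X j ω := by
      rw [← Finset.sum_add_distrib]
      refine Finset.sum_congr rfl fun i _ => ?_
      have : X i ω ^ 2 = ∑ j, if i = j then n i j * X i ω * X j ω else 0 := by
        rw [Finset.sum_ite_eq, if_pos (Finset.mem_univ i), hn, Matrix.diagNormalized_self hpos]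
        ring
      rw [this, ← Finset.sum_add_distrib]
      refine Finset.sum_congr rfl fun j _ => ?_
      simp only [hm]
      split_ifs <;> ring
    have e2 : ∑ i, (n.mulVec a) i * X i ω = ∑ i, ∑ j, n i j * a j * X i ω := by
      simp only [Matrix.mulVec, dotProduct, Finset.sum_mul]
    have e3 : ∑ i, (n.mulVec a) i * X i ω = ∑ i, ∑ j, n i j * a i * X j ω := by
      rw [e2, Finset.sum_comm]
      exact Finset.sum_congr rfl fun i _ => Finset.sum_congr rfl fun j _ => by
        rw [hn, hp.diagNormalized_symm]
    have e4 : b = ∑ i, ∑ j, n i j * a i * a j := by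
      simp only [hb, Matrix.mulVec, dotProduct, Finset.mul_sum]
      exact Finset.sum_congr rfl fun i _ => Finset.sum_congr rfl fun j _ => by ring
    rw [add_assoc, e1, two_mul]
    nth_rewrite 1 [e2]
    rw [e3, e4, ← Finset.sum_add_distrib, ← Finset.sum_add_distrib, ← Finset.sum_add_distrib]
    simp only [Matrix.mulVec, dotProduct, Finset.mul_sum]
    refine Finset.sum_congr rfl fun i _ => ?_
    rw [← Finset.sum_add_distrib, ← Finset.sum_add_distrib, ← Finset.sum_add_distrib]
    exact Finset.sum_congr rfl fun j _ => by ring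
  have B1 := hX.measureReal_sum_sq_lt_le hvar hδ hΛ
  have B2 : P.real {ω | ∑ i, ∑ j, m i j * X i ω * X j ω < -δ} ≤ 2 * (τ * C) / δ ^ 2 := by
    refine measureReal_le_of_le_sq (Z := fun ω => ∑ i, ∑ j, m i j * X i ω * X j ω) hδ
      (hX.integrable_comp (F := fun x => (∑ i, ∑ j, m i j * x i * x j) ^ 2) (by fun_prop)) ?_
      fun ω hω => ?_
    · rw [hX.integral_sq_bilinear msymm mdiag]
      have : ∑ i, ∑ j, m i j ^ 2 * (∫ ω, X i ω ^ 2 ∂P) * ∫ ω, X j ω ^ 2 ∂P ≤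
          ∑ i, (∫ ω, X i ω ^ 2 ∂P) * (τ * C) := by
        refine Finset.sum_le_sum fun i _ => ?_
        calc ∑ j, m i j ^ 2 * (∫ ω, X i ω ^ 2 ∂P) * ∫ ω, X j ω ^ 2 ∂P
            ≤ ∑ j, (∫ ω, X i ω ^ 2 ∂P) * τ * n i j ^ 2 := Finset.sum_le_sum fun j _ => by
              calc m i j ^ 2 * (∫ ω, X i ω ^ 2 ∂P) * ∫ ω, X j ω ^ 2 ∂P
                  ≤ n i j ^ 2 * (∫ ω, X i ω ^ 2 ∂P) * τ :=
                    mul_le_mul (mul_le_mul_of_nonneg_right (msq i j) (hs0 i)) (hsτ j) (hs0 j)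
                      (mul_nonneg (sq_nonneg _) (hs0 i))
                _ = _ := by ring
          _ ≤ (∫ ω, X i ω ^ 2 ∂P) * τ * (C * 1) := by
              rw [← Finset.mul_sum]
              exact mul_le_mul_of_nonneg_left (hrow i) (mul_nonneg (hs0 i) hτ0)
          _ = _ := by ring
      rw [← Finset.sum_mul, hvar, one_mul] at this
      linarith
    · have h : ∑ i, ∑ j, m i j * X i ω * X j ω < -δ := hω
      rw [abs_of_neg (by linarith)]
      linarith
  have B3 : P.real {ω | 2 * ∑ i, (n.mulVec a) i * X i ω < -(δ * (1 + b))} ≤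
      4 * (τ * C) / δ ^ 2 := by
    refine measureReal_le_of_le_sq (Z := fun ω => ∑ i, 2 * (n.mulVec a) i / (1 + b) * X i ω) hδ
      (hX.integrable_comp (F := fun x => (∑ i, 2 * (n.mulVec a) i / (1 + b) * x i) ^ 2)
        (by fun_prop)) ?_ fun ω hω => ?_
    · rw [hX.integral_sq_linear]
      calc ∑ i, (2 * (n.mulVec a) i / (1 + b)) ^ 2 * ∫ ω, X i ω ^ 2 ∂P
          ≤ ∑ i, (2 * (n.mulVec a) i / (1 + b)) ^ 2 * τ := Finset.sum_le_sum fun i _ =>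
            mul_le_mul_of_nonneg_left (hsτ i) (sq_nonneg _)
        _ = 4 * τ / (1 + b) ^ 2 * ∑ i, (n.mulVec a) i ^ 2 := by
            rw [Finset.mul_sum]
            exact Finset.sum_congr rfl fun i _ => by rw [div_pow]; ring
        _ ≤ 4 * τ / (1 + b) ^ 2 * (C * b) := by gcongr
        _ = 4 * (τ * C) * (b / (1 + b) ^ 2) := by ring
        _ ≤ 4 * (τ * C) * 1 := by
            gcongr
            rw [div_le_one (by positivity)]
            nlinarith
        _ = 4 * (τ * C) := mul_one _
    · have h : 2 * ∑ i, (n.mulVec a) i * X i ω < -(δ * (1 + b)) := hω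
      have h1b : 0 < 1 + b := by linarith
      have e : ∑ i, 2 * (n.mulVec a) i / (1 + b) * X i ω =
          (2 * ∑ i, (n.mulVec a) i * X i ω) / (1 + b) := by
        rw [Finset.mul_sum, Finset.sum_div]
        exact Finset.sum_congr rfl fun i _ => by ring
      rw [e, abs_div, abs_of_pos h1b, le_div_iff₀ h1b, abs_of_neg (by nlinarith)]
      linarith
  have hsub : {ω | (fun i => a i + X i ω) ⬝ᵥ (n.mulVec fun i => a i + X i ω) < 1 - 4 * δ} ⊆
      ({ω | ∑ i, X i ω ^ 2 < 1 - 2 * δ} ∪ {ω | ∑ i, ∑ j, m i j * X i ω * X j ω < -δ}) ∪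
        {ω | 2 * ∑ i, (n.mulVec a) i * X i ω < -(δ * (1 + b))} := by
    intro ω hω
    by_contra hc
    simp only [Set.mem_union, Set.mem_ofPred_eq, not_or, not_lt] at hc
    have h : (fun i => a i + X i ω) ⬝ᵥ (n.mulVec fun i => a i + X i ω) < 1 - 4 * δ := hω
    rw [decomp] at h
    nlinarith
  calc _ ≤ _ := measureReal_mono hsub
    _ ≤ _ := (measureReal_union_le _ _).trans (add_le_add (measureReal_union_le _ _) le_rfl)
    _ ≤ ε ^ 2 / δ ^ 2 + 2 * (τ * C) / δ ^ 2 + 4 * (τ * C) / δ ^ 2 :=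
      add_le_add (add_le_add B1 B2) B3
    _ = _ := by ring

end CenteredIndep

section Gaussian

theorem measureReal_gaussianReal_Iio_neg (x : ℝ) :
    (gaussianReal 0 1).real (Set.Iio (-x)) = (gaussianReal 0 1).real (Set.Ioi x) := by
  conv_lhs => rw [← neg_zero, ← gaussianReal_map_neg]
  rw [map_measureReal_apply measurable_neg measurableSet_Iio]
  congr 1
  ext y
  simp

theorem cdf_gaussianReal_zero : cdf (gaussianReal 0 1) 0 = 1 / 2 := by
  have hna : NullSingletonClass (gaussianReal 0 1) := nullSingletonClass_gaussianReal one_ne_zero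
  have h1 := measureReal_gaussianReal_Iio_neg 0
  have h2 := probReal_compl_eq_one_sub (μ := gaussianReal 0 1) (measurableSet_Iic (a := (0 : ℝ)))
  rw [Set.compl_Iic] at h2
  rw [neg_zero, measureReal_congr (Iio_ae_eq_Iic (μ := gaussianReal 0 1) (a := (0 : ℝ)))] at h1
  rw [cdf_eq_real]
  linarith

namespace DoseStudy

theorem le_cdf_normalQuantile {p : ℝ} (hp0 : 1 / 2 < p) (hp1 : p < 1) :
    0 ≤ normalQuantile p ∧ p ≤ cdf (gaussianReal 0 1) (normalQuantile p) := by
  set s := {x : ℝ | p ≤ cdf (gaussianReal 0 1) x} with hs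
  have hlow : ∀ x ∈ s, 0 ≤ x := fun x hx => by
    by_contra hc
    have h := monotone_cdf (gaussianReal 0 1) (not_le.1 hc).le
    rw [cdf_gaussianReal_zero] at h
    have hx' : p ≤ cdf (gaussianReal 0 1) x := hx
    linarith
  have hne : s.Nonempty :=
    ((tendsto_cdf_atTop (gaussianReal 0 1)).eventually (eventually_ge_nhds hp1)).exists
  have hq : normalQuantile p = sInf s := rfl
  refine ⟨Real.sInf_nonneg hlow, ?_⟩
  have hright := ((cdf (gaussianReal 0 1)).right_continuous (normalQuantile p)).mono
    Set.Ioi_subset_Ici_self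
  refine ge_of_tendsto hright ?_
  filter_upwards [self_mem_nhdsWithin] with y hy
  obtain ⟨x, hx, hxy⟩ := exists_lt_of_csInf_lt hne (hq ▸ hy : sInf s < y)
  exact le_trans hx (monotone_cdf (gaussianReal 0 1) hxy.le)

theorem one_sub_le_gaussianReal_Ioo {α : ℝ} (hα0 : 0 < α) (hα1 : α < 1) :
    1 - α ≤ (gaussianReal 0 1).real
      (Set.Ioo (-normalQuantile (1 - α / 2)) (normalQuantile (1 - α / 2))) := by
  have hna : NullSingletonClass (gaussianReal 0 1) := nullSingletonClass_gaussianReal one_ne_zero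
  obtain ⟨-, h⟩ := le_cdf_normalQuantile (p := 1 - α / 2) (by linarith) (by linarith)
  set z := normalQuantile (1 - α / 2)
  rw [cdf_eq_real] at h
  rw [measureReal_congr (Ioo_ae_eq_Icc (μ := gaussianReal 0 1))]
  have h2 := probReal_compl_eq_one_sub (μ := gaussianReal 0 1) (measurableSet_Iic (a := z))
  rw [Set.compl_Iic] at h2
  have h3 := measureReal_gaussianReal_Iio_neg z
  have h4 : (gaussianReal 0 1).real Set.univ ≤ (gaussianReal 0 1).real (Set.Icc (-z) z) +
      ((gaussianReal 0 1).real (Set.Iio (-z)) + (gaussianReal 0 1).real (Set.Ioi z)) := by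
    refine le_trans (measureReal_mono fun x _ => ?_) ((measureReal_union_le _ _).trans
      (add_le_add le_rfl (measureReal_union_le _ _)))
    rcases lt_or_ge x (-z) with hx | hx
    · exact Or.inr (Or.inl hx)
    · rcases lt_or_ge z x with hx' | hx'
      · exact Or.inr (Or.inr hx')
      · exact Or.inl ⟨hx, hx'⟩
  rw [probReal_univ] at h4
  linarith

end DoseStudy

end Gaussian

/-- If the characteristic functions converge, then the mass of an open set is asymptotically at
least that under the limiting law. -/
theorem eventually_measureReal_open_gt {μ : ℕ → ProbabilityMeasure ℝ} {ν : ProbabilityMeasure ℝ}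
    (h : ∀ t, Tendsto (fun n => charFun (μ n : Measure ℝ) t) atTop
      (nhds (charFun (ν : Measure ℝ) t)))
    {G : Set ℝ} (hG : IsOpen G) {x : ℝ} (hx : x < (ν : Measure ℝ).real G) :
    ∀ᶠ n in atTop, x < (μ n : Measure ℝ).real G := by
  have ht := ProbabilityMeasure.tendsto_of_tendsto_charFun h
  have hl := ProbabilityMeasure.le_liminf_measure_open_of_tendsto ht hG
  rcases lt_or_ge x 0 with h0 | h0
  · exact Eventually.of_forall fun n => h0.trans_le measureReal_nonneg
  have hx' : ENNReal.ofReal x < (ν : Measure ℝ) G :=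
    (ENNReal.ofReal_lt_iff_lt_toReal h0 (measure_ne_top _ _)).2 hx
  filter_upwards [eventually_lt_of_lt_liminf (hx'.trans_le hl)] with n hn
  exact (ENNReal.ofReal_lt_iff_lt_toReal h0 (measure_ne_top _ _)).1 hn

/-- The mass of `(-z, z)` is approximated by that of `(-c, c)` with `c < z`. -/
theorem exists_lt_measureReal_Ioo_gt (ν : Measure ℝ) [IsFiniteMeasure ν] {z x : ℝ} (h0 : 0 ≤ x)
    (hx : x < ν.real (Set.Ioo (-z) z)) :
    ∃ c < z, x < ν.real (Set.Ioo (-c) c) := by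
  obtain ⟨k, hk, hkc, hxk⟩ := isOpen_Ioo.exists_lt_isCompact
    ((ENNReal.ofReal_lt_iff_lt_toReal h0 (measure_ne_top ν _)).2 hx)
  have hxk' : x < ν.real k := (ENNReal.ofReal_lt_iff_lt_toReal h0 (measure_ne_top _ _)).1 hxk
  have hne : k.Nonempty := by
    rw [Set.nonempty_iff_ne_empty]
    rintro rfl
    rw [measureReal_empty] at hxk'
    linarith
  obtain ⟨y, hy, hmax⟩ := hkc.exists_isMaxOn hne continuous_abs.continuousOn
  have hyz : |y| < z := abs_lt.2 (hk hy)
  refine ⟨(|y| + z) / 2, by linarith,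
    hxk'.trans_le (measureReal_mono fun w hw => ?_)⟩
  have : |w| ≤ |y| := hmax hw
  exact abs_lt.1 (by linarith)

theorem integral_comp_finite {Ω β : Type*} [MeasurableSpace Ω] {P : Measure Ω} [IsFiniteMeasure P]
    [Fintype β] {f : Ω → β} (hf : @Measurable Ω β _ ⊤ f) (g : β → ℝ) :
    ∫ ω, g (f ω) ∂P = ∑ b, P.real {ω | f ω = b} * g b := by
  classical
  have hm : ∀ b, MeasurableSet {ω | f ω = b} := fun b =>
    hf (show MeasurableSet[⊤] {b} from trivial)
  have h : ∀ ω, g (f ω) = ∑ b, Set.indicator {ω | f ω = b} (fun _ => g b) ω := fun ω => by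
    rw [Finset.sum_eq_single (f ω)]
    · simp
    · intro b _ hb
      exact Set.indicator_of_notMem (fun h => hb h.symm) _
    · simp
  simp only [h]
  rw [integral_finsetSum _ fun b _ => (integrable_const _).indicator (hm b)]
  exact Finset.sum_congr rfl fun b _ => by rw [integral_indicator_const _ (hm b), smul_eq_mul]

/-- The average over all permutations of `∑ j, f j (π j)`. -/
theorem card_mul_sum_perm_sum_apply {n : ℕ} (f : Fin n → Fin n → ℝ) :
    (n : ℝ) * ∑ π : Equiv.Perm (Fin n), ∑ j, f j (π j) = (n ! : ℝ) * ∑ j, ∑ k, f j k := by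
  have key : ∀ (g : Fin n → ℝ) (j : Fin n),
      (n : ℝ) * ∑ π : Equiv.Perm (Fin n), g (π j) = (n ! : ℝ) * ∑ k, g k := by
    intro g j
    have h1 : ∀ i, ∑ π : Equiv.Perm (Fin n), g (π i) = ∑ π : Equiv.Perm (Fin n), g (π j) :=
      fun i => by
        rw [← Equiv.sum_comp (Equiv.mulRight (Equiv.swap i j))]
        simp
    have h2 : ∑ i, ∑ π : Equiv.Perm (Fin n), g (π i) = (n ! : ℝ) * ∑ k, g k := by
      rw [Finset.sum_comm, Finset.sum_congr rfl fun π _ => Equiv.sum_comp π g]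
      simp [Fintype.card_perm]
    rw [← h2, Finset.sum_congr rfl fun i _ => h1 i]
    simp
  rw [Finset.sum_comm, Finset.mul_sum, Finset.mul_sum]
  exact Finset.sum_congr rfl fun j _ => key (f j) j

namespace DoseStudy

variable (S : DoseStudy)

theorem setEstimator_eq_sum (i : Fin S.numSets) (π : S.SetAssignment i) :
    S.setEstimator i π = ∑ j, S.contrast i (π j) (S.orderedDose i (π j))
      (S.outcome i j (S.orderedDose i (π j))) := by
  simp [setEstimator, assignedDose, observedOutcome]

theorem sum_deviation (i : Fin S.numSets) : ∑ π, S.deviation i π = 0 := by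
  have h := card_mul_sum_perm_sum_apply fun j k =>
    S.contrast i k (S.orderedDose i k) (S.outcome i j (S.orderedDose i k))
  have hn : (S.size i : ℝ) ≠ 0 := Nat.cast_ne_zero.2 (S.size_pos i).ne'
  simp only [deviation, setEstimator_eq_sum]
  rw [← Finset.mul_sum, Finset.sum_sub_distrib, mul_sub, h, Finset.sum_const, setEstimand]
  simp only [Finset.card_univ, Fintype.card_perm, Fintype.card_fin, nsmul_eq_mul]
  field_simp
  ring

theorem scaleSq_nonneg : 0 ≤ S.scaleSq :=
  Finset.sum_nonneg fun i _ => by positivity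

theorem deviation_eq_zero (h : S.scaleSq = 0) (i : Fin S.numSets) (π : S.SetAssignment i) :
    S.deviation i π = 0 := by
  have h1 := (Finset.sum_eq_zero_iff_of_nonneg fun i _ => by positivity).1 h i (Finset.mem_univ i)
  have h2 := (mul_eq_zero.1 h1).resolve_left (by positivity)
  have h3 := (Finset.sum_eq_zero_iff_of_nonneg fun π _ => by positivity).1 h2 π (Finset.mem_univ π)
  exact pow_eq_zero_iff two_ne_zero |>.1 h3

theorem estimator_sub_estimand (π : S.Assignment) :
    S.estimator π - S.estimand = (∑ i, S.deviation i (π i)) / S.total := by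
  rw [estimator, estimand, ← Finset.sum_sub_distrib, Finset.sum_div]
  exact Finset.sum_congr rfl fun i _ => by rw [deviation]; ring

theorem total_pos (i : Fin S.numSets) : 0 < S.total :=
  (S.size_pos i).trans_le (Finset.single_le_sum (f := S.size) (fun _ _ => Nat.zero_le _)
    (Finset.mem_univ i))

/-- The normalized contribution `D_i / B` of set `i` to the error of the estimator. -/
noncomputable def normalizedDeviation {Ω : Type*} (A : (i : Fin S.numSets) → Ω → S.SetAssignment i)
    (i : Fin S.numSets) (ω : Ω) : ℝ :=
  S.deviation i (A i ω) / √S.scaleSq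

variable {S} {Ω : Type*} [MeasurableSpace Ω] {P : Measure Ω} [IsProbabilityMeasure P]
  {A : (i : Fin S.numSets) → Ω → S.SetAssignment i} (hA : S.RandomAssignment P A)
include hA

theorem RandomAssignment.integral_comp (i : Fin S.numSets) (g : S.SetAssignment i → ℝ) :
    ∫ ω, g (A i ω) ∂P = ((S.size i)! : ℝ)⁻¹ * ∑ π, g π := by
  rw [integral_comp_finite (hA.measurable i), Finset.mul_sum]
  exact Finset.sum_congr rfl fun π _ => by rw [hA.uniform, one_div]

theorem RandomAssignment.centeredIndep : CenteredIndep (S.normalizedDeviation A) P where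
  measurable i := by
    have h : @Measurable _ ℝ ⊤ _ fun π : S.SetAssignment i => S.deviation i π / √S.scaleSq :=
      measurable_from_top
    exact h.comp (hA.measurable i)
  bounded := by
    refine ⟨∑ i, ∑ π, |S.deviation i π / √S.scaleSq|, fun i ω => ?_⟩
    refine (Finset.single_le_sum (f := fun π => |S.deviation i π / √S.scaleSq|)
      (fun π _ => abs_nonneg _) (Finset.mem_univ (A i ω))).trans ?_
    exact Finset.single_le_sum (f := fun i => ∑ π, |S.deviation i π / √S.scaleSq|)
      (fun i _ => Finset.sum_nonneg fun π _ => abs_nonneg _) (Finset.mem_univ i)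
  indep := hA.independent.comp (fun i π => S.deviation i π / √S.scaleSq)
    fun _ => measurable_from_top
  mean i := by
    have := hA.integral_comp i fun π => S.deviation i π / √S.scaleSq
    rw [← Finset.sum_div, S.sum_deviation, zero_div, mul_zero] at this
    exact this

theorem RandomAssignment.sum_integral_sq (hB : 0 < S.scaleSq) :
    ∑ i, ∫ ω, S.normalizedDeviation A i ω ^ 2 ∂P = 1 := by
  have h : ∀ i, ∫ ω, S.normalizedDeviation A i ω ^ 2 ∂P =
      (((S.size i)! : ℝ)⁻¹ * ∑ π, S.deviation i π ^ 2) / S.scaleSq := fun i => by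
    have := hA.integral_comp i fun π => (S.deviation i π / √S.scaleSq) ^ 2
    refine this.trans ?_
    simp only [div_pow, Real.sq_sqrt hB.le]
    rw [← Finset.sum_div, mul_div_assoc]
  rw [Finset.sum_congr rfl fun i _ => h i, ← Finset.sum_div]
  exact div_self hB.ne'

theorem RandomAssignment.lindebergSum_eq (hB : 0 < S.scaleSq) (ε : ℝ) :
    lindebergSum (S.normalizedDeviation A) P ε = S.truncatedSq ε / S.scaleSq := by
  have hs : 0 < √S.scaleSq := Real.sqrt_pos.2 hB
  rw [truncatedSq, Finset.sum_div, lindebergSum]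
  refine Finset.sum_congr rfl fun i _ => ?_
  refine (hA.integral_comp i fun π => if ε < |S.deviation i π / √S.scaleSq| then
    (S.deviation i π / √S.scaleSq) ^ 2 else 0).trans ?_
  rw [mul_div_assoc, Finset.sum_div]
  congr 1
  refine Finset.sum_congr rfl fun π _ => ?_
  simp only [abs_div, abs_of_pos hs, lt_div_iff₀ hs, div_pow, Real.sq_sqrt hB.le]
  split_ifs <;> simp

omit hA

theorem sum_normalizedDeviation (hB : 0 < S.scaleSq) (ω : Ω) :
    S.estimator (fun i => A i ω) - S.estimand =
      √S.scaleSq / S.total * ∑ i, S.normalizedDeviation A i ω := by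
  have hs : √S.scaleSq ≠ 0 := (Real.sqrt_pos.2 hB).ne'
  simp only [estimator_sub_estimand, normalizedDeviation]
  rw [← Finset.sum_div]
  field_simp

theorem varianceEstimator_eq (hB : 0 < S.scaleSq) {L : ℕ} (Q : Matrix (Fin S.numSets) (Fin L) ℝ)
    (ω : Ω) :
    S.varianceEstimator Q (fun i => A i ω) = (√S.scaleSq / S.total) ^ 2 *
      ((fun i => S.size i * S.setEstimand i / √S.scaleSq + S.normalizedDeviation A i ω) ⬝ᵥ
        ((1 - hatMatrix Q).diagNormalized.mulVec fun i =>
          S.size i * S.setEstimand i / √S.scaleSq + S.normalizedDeviation A i ω)) := by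
  have hs : √S.scaleSq ≠ 0 := (Real.sqrt_pos.2 hB).ne'
  have e : ∀ i, S.size i * S.setEstimand i / √S.scaleSq + S.normalizedDeviation A i ω =
      S.size i * S.setEstimator i (A i ω) / √S.scaleSq := fun i => by
    rw [normalizedDeviation, deviation]; ring
  have hd : ∀ i, (1 - hatMatrix Q) i i = 1 - hatMatrix Q i i := fun i => by simp
  simp only [e, varianceEstimator, weightMatrix, dotProduct, Matrix.mulVec, Matrix.mul_diagonal,
    Matrix.diagonal_mul, Matrix.diagNormalized, adjusted, Finset.mul_sum, hd]
  refine Finset.sum_congr rfl fun i _ => Finset.sum_congr rfl fun j _ => ?_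
  have hI : (S.numSets : ℝ) ≠ 0 := Nat.cast_ne_zero.2 (Fin.pos i).ne'
  have hN : (S.total : ℝ) ≠ 0 := Nat.cast_ne_zero.2 (S.total_pos i).ne'
  field_simp

theorem estimand_mem_confidenceInterval (hB : 0 < S.scaleSq) {L : ℕ}
    {Q : Matrix (Fin S.numSets) (Fin L) ℝ} {α c z q : ℝ} {ω : Ω}
    (hz : z = normalQuantile (1 - α / 2)) (hz0 : 0 ≤ z) (hcq : c ≤ z * √q)
    (hX : |∑ i, S.normalizedDeviation A i ω| ≤ c)
    (hq : q ≤ (fun i => S.size i * S.setEstimand i / √S.scaleSq + S.normalizedDeviation A i ω) ⬝ᵥ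
        ((1 - hatMatrix Q).diagNormalized.mulVec fun i =>
          S.size i * S.setEstimand i / √S.scaleSq + S.normalizedDeviation A i ω)) :
    S.estimand ∈ S.confidenceInterval Q α fun i => A i ω := by
  have hk : 0 ≤ √S.scaleSq / S.total := by positivity
  have hlen : √S.scaleSq / S.total * c ≤ z * √(S.varianceEstimator Q fun i => A i ω) := by
    rw [varianceEstimator_eq hB, Real.sqrt_mul (sq_nonneg _), Real.sqrt_sq hk]
    calc √S.scaleSq / S.total * c ≤ √S.scaleSq / S.total * (z * √q) := by gcongr
      _ = z * (√S.scaleSq / S.total * √q) := by ring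
      _ ≤ _ := by gcongr
  have hdev : |S.estimator (fun i => A i ω) - S.estimand| ≤ √S.scaleSq / S.total * c := by
    rw [sum_normalizedDeviation hB, abs_mul, abs_of_nonneg hk]
    gcongr
  have := abs_le.1 (hdev.trans hlen)
  rw [confidenceInterval, ← hz]
  exact ⟨by linarith, by linarith⟩

theorem estimand_mem_confidenceInterval_of_scaleSq_eq_zero (hB : S.scaleSq = 0) {L : ℕ}
    {Q : Matrix (Fin S.numSets) (Fin L) ℝ} {α : ℝ} (hz : 0 ≤ normalQuantile (1 - α / 2))
    (π : S.Assignment) : S.estimand ∈ S.confidenceInterval Q α π := by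
  have h := S.estimator_sub_estimand π
  simp only [S.deviation_eq_zero hB, Finset.sum_const_zero, zero_div] at h
  have h2 : 0 ≤ normalQuantile (1 - α / 2) * √(S.varianceEstimator Q π) := by positivity
  exact ⟨by linarith, by linarith⟩

include hA in
/-- Lower bound for the coverage in a single study. -/
theorem RandomAssignment.coverage_ge (hB : 0 < S.scaleSq) {L : ℕ}
    {Q : Matrix (Fin S.numSets) (Fin L) ℝ} (hQ : IsUnit (Q.transpose * Q))
    (hlev : ∀ i, hatMatrix Q i i < 1) {η : ℝ} (hη : η < 1) {K : ℕ}
    (hK : {i | η < hatMatrix Q i i}.ncard ≤ K) {α c ε δ : ℝ}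
    (hz0 : 0 ≤ normalQuantile (1 - α / 2)) (hδ : 0 < δ) (hδ1 : δ < 1)
    (hc : c ≤ normalQuantile (1 - α / 2) * √(1 - 4 * δ))
    (hΛ : lindebergSum (S.normalizedDeviation A) P ε ≤ δ) :
    P.real {ω | ∑ i, S.normalizedDeviation A i ω ∈ Set.Ioo (-c) c} -
      (ε ^ 2 + 6 * (ε ^ 2 + lindebergSum (S.normalizedDeviation A) P ε) * (K + (1 - η)⁻¹)) /
        δ ^ 2 ≤
      P.real {ω | S.estimand ∈ S.confidenceInterval Q α fun i => A i ω} := by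
  have hd : ∀ i, (1 - hatMatrix Q) i i = 1 - hatMatrix Q i i := fun i => by simp
  have hset : {i | (1 - hatMatrix Q) i i < 1 - η} = {i | η < hatMatrix Q i i} := by
    ext i
    simp
  have h := hA.centeredIndep.measureReal_quadraticForm_lt_le (hA.sum_integral_sq hB)
    (isProjection_one_sub_hatMatrix hQ) (fun i => by rw [hd]; linarith [hlev i])
    (sub_pos.2 hη) (hset ▸ hK) (fun i => S.size i * S.setEstimand i / √S.scaleSq) hδ hδ1 hΛ
  rw [sub_le_iff_le_add]
  refine le_trans ?_ (add_le_add le_rfl h)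
  refine le_trans (measureReal_mono fun ω hω => ?_) (measureReal_union_le _ _)
  by_contra hcon
  rw [Set.mem_union, not_or] at hcon
  refine hcon.1 (estimand_mem_confidenceInterval hB rfl hz0 hc (abs_lt.2 hω).le ?_)
  exact not_lt.1 hcon.2

end DoseStudy

open DoseStudy in
theorem mainTheorem2
    (T : ℕ → DoseStudy)
    (hI : Tendsto (fun m => (T m).numSets) atTop atTop)
    {Ω : ℕ → Type*} [∀ m, MeasurableSpace (Ω m)]
    (P : (m : ℕ) → Measure (Ω m)) [∀ m, IsProbabilityMeasure (P m)]
    (A : (m : ℕ) → (i : Fin (T m).numSets) → Ω m → (T m).SetAssignment i)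
    (hA : ∀ m, (T m).RandomAssignment (P m) (A m))
    (L : ℕ → ℕ) (hL : ∀ m, L m < (T m).numSets)
    (Q : (m : ℕ) → Matrix (Fin (T m).numSets) (Fin (L m)) ℝ)
    (hQ : ∀ m, IsUnit ((Q m).transpose * Q m))
    (hlev_lt : ∀ m i, DoseStudy.hatMatrix (Q m) i i < 1)
    (hlev : ∃ η : ℝ, η < 1 ∧ ∃ K : ℕ, ∀ m,
      {i | η < DoseStudy.hatMatrix (Q m) i i}.ncard ≤ K)
    (hLin : DoseStudy.Lindeberg T)
    (α : ℝ) (hα0 : 0 < α) (hα1 : α < 1) :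
    1 - α ≤ liminf (fun m => (P m).real
      {ω | (T m).estimand ∈ (T m).confidenceInterval (Q m) α (fun i => A m i ω)}) atTop := by
  classical
  obtain ⟨η, hη, K, hK⟩ := hlev
  obtain ⟨hz0, -⟩ := le_cdf_normalQuantile (p := 1 - α / 2) (by linarith) (by linarith)
  have hgauss := one_sub_le_gaussianReal_Ioo hα0 hα1
  set z := normalQuantile (1 - α / 2) with hz
  have hbdd : IsCoboundedUnder (· ≥ ·) atTop fun m => (P m).real
      {ω | (T m).estimand ∈ (T m).confidenceInterval (Q m) α (fun i => A m i ω)} :=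
    IsBoundedUnder.isCoboundedUnder_ge ⟨1, eventually_map.2 <| Eventually.of_forall fun m =>
      measureReal_le_one (μ := P m)⟩
  refine le_of_forall_lt fun x hx => ?_
  obtain ⟨y, hxy, hy⟩ := exists_between hx
  rcases lt_or_ge y 0 with hy0 | hy0
  · exact hxy.trans_le (le_liminf_of_le hbdd
      (Eventually.of_forall fun m => hy0.le.trans measureReal_nonneg))
  refine hxy.trans_le (le_liminf_of_le hbdd ?_)
  obtain ⟨y', hyy', hy'⟩ := exists_between hy
  obtain ⟨c, hcz, hc⟩ := exists_lt_measureReal_Ioo_gt (gaussianReal 0 1) (hy0.trans hyy'.le)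
    (hy'.trans_le hgauss)
  -- the shrinkage of the quadratic form that still leaves an interval of half-width `c`
  obtain ⟨δ, hδ0, hδ1, hδc⟩ : ∃ δ : ℝ, 0 < δ ∧ δ < 1 ∧ c ≤ z * √(1 - 4 * δ) := by
    have ht : Tendsto (fun δ : ℝ => z * √(1 - 4 * δ)) (nhdsWithin 0 (Set.Ioi 0))
        (nhds (z * √(1 - 4 * 0))) :=
      ((by fun_prop : Continuous fun δ : ℝ => z * √(1 - 4 * δ)).tendsto 0).mono_left
        nhdsWithin_le_nhds
    rw [mul_zero, sub_zero, Real.sqrt_one, mul_one] at ht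
    obtain ⟨δ, hδ, h1, h2⟩ := ((eventually_mem_nhdsWithin (a := (0 : ℝ)) (s := Set.Ioi 0)).and
      ((ht.eventually (eventually_ge_nhds hcz)).and
        (nhdsWithin_le_nhds (eventually_lt_nhds (zero_lt_one (α := ℝ)))))).exists
    exact ⟨δ, hδ, h2, h1⟩
  have hΛ : ∀ ε : ℝ, 0 < ε → ∀ δ : ℝ, 0 < δ → ∀ᶠ m in atTop, 0 < (T m).scaleSq →
      lindebergSum ((T m).normalizedDeviation (A m)) (P m) ε ≤ δ := fun ε hε δ hδ => by
    filter_upwards [hLin ε hε δ hδ] with m hm hB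
    rw [(hA m).lindebergSum_eq hB]
    exact (div_le_iff₀ hB).2 hm
  have hpm : ∀ m, IsProbabilityMeasure
      ((P m).map fun ω => ∑ i, (T m).normalizedDeviation (A m) i ω) := fun m =>
    Measure.isProbabilityMeasure_map
      (Finset.measurable_sum _ fun i _ => (hA m).centeredIndep.measurable i).aemeasurable
  -- studies without any deviation are given the limiting law
  have hex : ∀ m, ∃ μ : ProbabilityMeasure ℝ, (0 < (T m).scaleSq → (μ : Measure ℝ) =
      (P m).map fun ω => ∑ i, (T m).normalizedDeviation (A m) i ω) ∧
      (¬ 0 < (T m).scaleSq → (μ : Measure ℝ) = gaussianReal 0 1) := fun m => by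
    by_cases hB : 0 < (T m).scaleSq
    · exact ⟨⟨_, hpm m⟩, fun _ => rfl, fun h => (h hB).elim⟩
    · exact ⟨⟨gaussianReal 0 1, inferInstance⟩, fun h => (hB h).elim, fun _ => rfl⟩
  choose μ hμ hμ0 using hex
  have hchar : ∀ t, Tendsto (fun m => charFun (μ m : Measure ℝ) t) atTop
      (nhds (charFun (gaussianReal 0 1) t)) := fun t => by
    rw [Metric.tendsto_atTop']
    intro ρ hρ
    have hlim : Tendsto (fun ε : ℝ => 4 * |t| ^ 3 * ε + 4 * t ^ 2 * ε + t ^ 4 * (ε ^ 2 + ε))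
        (nhdsWithin 0 (Set.Ioi 0)) (nhds 0) := by
      have := ((by fun_prop : Continuous fun ε : ℝ =>
        4 * |t| ^ 3 * ε + 4 * t ^ 2 * ε + t ^ 4 * (ε ^ 2 + ε)).tendsto 0).mono_left
          (nhdsWithin_le_nhds (s := Set.Ioi 0))
      simpa using this
    obtain ⟨ε, hε, hερ⟩ := ((eventually_mem_nhdsWithin (a := (0 : ℝ)) (s := Set.Ioi 0)).and
      (hlim.eventually (eventually_lt_nhds hρ))).exists
    obtain ⟨M, hM⟩ := eventually_atTop.1 (hΛ ε hε ε hε)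
    refine ⟨M, fun m hm => ?_⟩
    rw [dist_eq_norm]
    by_cases hB : 0 < (T m).scaleSq
    · have hb := (hA m).centeredIndep.norm_charFun_map_sum_sub_le ((hA m).sum_integral_sq hB) t hε
      have hl := hM m hm.le hB
      rw [hμ m hB]
      refine (hb.trans ?_).trans_lt hερ
      gcongr
    · rw [hμ0 m hB, sub_self, norm_zero]
      exact hρ
  have hclt := eventually_measureReal_open_gt (ν := ⟨gaussianReal 0 1, inferInstance⟩) hchar
    (isOpen_Ioo (a := -c) (b := c)) hc
  obtain ⟨ε, hε, hεδ⟩ : ∃ ε : ℝ, 0 < ε ∧ ε ≤ δ ∧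
      (ε ^ 2 + 6 * (ε ^ 2 + ε) * (K + (1 - η)⁻¹)) / δ ^ 2 < y' - y := by
    have hlim : Tendsto (fun ε : ℝ => (ε ^ 2 + 6 * (ε ^ 2 + ε) * (K + (1 - η)⁻¹)) / δ ^ 2)
        (nhdsWithin 0 (Set.Ioi 0)) (nhds 0) := by
      have := ((by fun_prop : Continuous fun ε : ℝ =>
        (ε ^ 2 + 6 * (ε ^ 2 + ε) * (K + (1 - η)⁻¹)) / δ ^ 2).tendsto 0).mono_left
          (nhdsWithin_le_nhds (s := Set.Ioi 0))
      simpa using this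
    obtain ⟨ε, hε, h1, h2⟩ := ((eventually_mem_nhdsWithin (a := (0 : ℝ)) (s := Set.Ioi 0)).and
      ((hlim.eventually (eventually_lt_nhds (sub_pos.2 hyy'))).and
        (nhdsWithin_le_nhds (eventually_le_nhds hδ0)))).exists
    exact ⟨ε, hε, h2, h1⟩
  filter_upwards [hclt, hΛ ε hε ε hε] with m hm1 hm2
  by_cases hB : 0 < (T m).scaleSq
  · have hcov := (hA m).coverage_ge hB (hQ m) (hlev_lt m) hη (hK m) (α := α) (c := c) (ε := ε)
      hz0 hδ0 hδ1 hδc ((hm2 hB).trans hεδ.1)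
    rw [hμ m hB, map_measureReal_apply
      (Finset.measurable_sum _ fun i _ => (hA m).centeredIndep.measurable i)
      measurableSet_Ioo] at hm1
    have hmono : (ε ^ 2 + 6 * (ε ^ 2 + lindebergSum ((T m).normalizedDeviation (A m)) (P m) ε) *
        (K + (1 - η)⁻¹)) / δ ^ 2 ≤ (ε ^ 2 + 6 * (ε ^ 2 + ε) * (K + (1 - η)⁻¹)) / δ ^ 2 := by
      have : 0 ≤ (1 - η)⁻¹ := inv_nonneg.2 (sub_pos.2 hη).le
      gcongr
      exact hm2 hB
    have hpre : (P m).real ((fun ω => ∑ i, (T m).normalizedDeviation (A m) i ω) ⁻¹'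
        Set.Ioo (-c) c) =
        (P m).real {ω | ∑ i, (T m).normalizedDeviation (A m) i ω ∈ Set.Ioo (-c) c} := rfl
    linarith [hεδ.2]
  · have hB0 : (T m).scaleSq = 0 := le_antisymm (not_lt.1 hB) (T m).scaleSq_nonneg
    have : {ω | (T m).estimand ∈ (T m).confidenceInterval (Q m) α (fun i => A m i ω)} =
        Set.univ := Set.eq_univ_of_forall fun ω =>
      estimand_mem_confidenceInterval_of_scaleSq_eq_zero hB0 hz0 _
    rw [this, probReal_univ]
    linarith
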